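/- Fix a resource theory on finite-dimensional Hilbert spaces: to each Hilbert space $\mathcal{H}$ under consideration there belongs a set $\mathcal{F}(\mathcal{H})\subseteq\mathcal{D}(\mathcal{H})$ of free states, where $\mathcal{D}(\mathcal{H})$ is the set of density operators on $\mathcal{H}$. Let $\Lambda$ be a resource destroying (RD) channel, that is, on each of these spaces a completely positive trace-preserving (CPTP) map $\Lambda$ with $\Lambda(\omega)\in\mathcal{F}$ for every state $\omega\notin\mathcal{F}$ and $\Lambda(\sigma)=\sigma$ for every $\sigma\in\mathcal{F}$. Let $\mathbb{D}\subseteq\mathbb{Z}_+$, and let $\{\Phi_d\}_{d\in\mathbb{D}}$ be a family of pure (reference) states $\Phi_d\in\mathcal{D}(\mathcal{H}_d)$ with $\dim\mathcal{H}_d=d$. Let $\rho$ be a state on a finite-dimensional Hilbert space and let $\epsilon\ge 0$. Logarithms are to base $2$. Write - $f(\rho,\sigma)=\big(\mathrm{Tr}\sqrt{\sqrt{\sigma}\,\rho\sqrt{\sigma}}\big)^2$ for the fidelity, $\mathcal{B}^\epsilon(\rho)=\{\rho'\text{ a state}: f(\rho',\rho)\ge 1-\epsilon\}$, and $\mathfrak{f}_\Lambda(\rho)=f(\rho,\Lambda(\rho))$;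 - $\mathfrak{D}^\epsilon_{H,\Lambda}(\rho)=\max\{-\log\mathrm{Tr}\{P\Lambda(\rho)\}: 0\le P\le I,\ \mathrm{Tr}\{P\rho\}\ge 1-\epsilon\}\in[0,\infty]$, with $2^{-\infty}=0$; - $m_{f,\Lambda}(\Phi_d)=-\log\mathfrak{f}_\Lambda(\Phi_d)/\log d$ for the modification coefficient; - $\Omega^{\epsilon}_{D,\mathscr{F}_{\Lambda,\mathrm{Comm}}}(\rho\to\{\Phi_d\})=\log\max\{d\in\mathbb{D}:\ \mathcal{E}(\rho)\in\mathcal{B}^\epsilon(\Phi_d)\text{ for some CPTP map }\mathcal{E}\text{ with }\Lambda\circ\mathcal{E}=\mathcal{E}\circ\Lambda\}$ for the one-shot $\epsilon$-distillation yield under commuting operations (the yield being $-\infty$ if there is no such $d$, and $+\infty$ if there are arbitrarily large ones). Suppose that the maximum $d_0=\max\{d\in\mathbb{D}:\ \mathfrak{f}_\Lambda(\Phi_d)\ge 2^{-\mathfrak{D}^\epsilon_{H,\Lambda}(\rho)}-2\sqrt{\epsilon}\}$ exists. Then $$\Omega^{\epsilon}_{D,\mathscr{F}_{\Lambda,\mathrm{Comm}}}(\rho\to\{\Phi_d\})\le\log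 d_0,$$ and, if moreover $2^{-\mathfrak{D}^\epsilon_{H,\Lambda}(\rho)}-2\sqrt{\epsilon}>0$, $d_0>1$ and $\mathfrak{f}_\Lambda(\Phi_{d_0})<1$ (so that the logarithm and the quotient below are defined), $$\Omega^{\epsilon}_{D,\mathscr{F}_{\Lambda,\mathrm{Comm}}}(\rho\to\{\Phi_d\})\le\frac{-\log\big(2^{-\mathfrak{D}^\epsilon_{H,\Lambda}(\rho)}-2\sqrt{\epsilon}\big)}{m_{f,\Lambda}(\Phi_{d_0})}.$$ -/

import Mathlib

namespace OneShot

noncomputable section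

open scoped ComplexOrder MatrixOrder

variable {ι κ : Type*} [Fintype ι] [DecidableEq ι] [Fintype κ] [DecidableEq κ]

/-- Linear maps from operators on `ℂ^ι` to operators on `ℂ^κ`. -/
abbrev SuperOp (ι κ : Type*) := Matrix ι ι ℂ →ₗ[ℂ] Matrix κ κ ℂ

/-- Density operators (states) on `ℂ^ι`. -/
def IsState (ρ : Matrix ι ι ℂ) : Prop :=
  ρ.PosSemidef ∧ ρ.trace = 1

/-- Pure states `|ψ⟩⟨ψ|` with `ψ` a unit vector of `ℂ^ι`. -/
def IsPureState (ρ : Matrix ι ι ℂ) : Prop :=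
  ∃ ψ : ι → ℂ, star ψ ⬝ᵥ ψ = 1 ∧ ρ = Matrix.vecMulVec ψ (star ψ)

/-- Complete positivity: for every `k`, applying `E` to each block of a positive semidefinite
`k × k` block matrix (that is, applying `id ⊗ E`) gives a positive semidefinite matrix. -/
def IsCompletelyPositive (E : SuperOp ι κ) : Prop :=
  ∀ (k : ℕ) (X : Matrix (Fin k) (Fin k) (Matrix ι ι ℂ)),
    (Matrix.comp (Fin k) (Fin k) ι ι ℂ X).PosSemidef →
      (Matrix.comp (Fin k) (Fin k) κ κ ℂ (X.map E)).PosSemidef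

/-- Quantum channels: completely positive trace-preserving linear maps. -/
def IsChannel (E : SuperOp ι κ) : Prop :=
  IsCompletelyPositive E ∧ ∀ X : Matrix ι ι ℂ, (E X).trace = X.trace

/-- `Λ` is a resource destroying channel for the set `F` of free states: a channel that maps every
non-free state to a free state and fixes every free state. -/
def IsRDChannel (F : Set (Matrix ι ι ℂ)) (Λ : SuperOp ι ι) : Prop :=
  IsChannel Λ ∧ (∀ ρ, IsState ρ → ρ ∉ F → Λ ρ ∈ F) ∧ ∀ σ ∈ F, Λ σ = σ

/-- The channels from operators on `ℂ^ι` to operators on `ℂ^κ` that commute with the resource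
destroying maps `Λ` (on the input system) and `Λ'` (on the output system). -/
def commutingOps (Λ : SuperOp ι ι) (Λ' : SuperOp κ κ) : Set (SuperOp ι κ) :=
  {E | IsChannel E ∧ Λ' ∘ₗ E = E ∘ₗ Λ}

/-- Uhlmann fidelity `(Tr √(√σ ρ √σ))²`. -/
def fidelity (ρ σ : Matrix ι ι ℂ) : ℝ :=
  (CFC.sqrt (CFC.sqrt σ * ρ * CFC.sqrt σ)).trace.re ^ 2

/-- The states `ρ'` with `f(ρ', ρ) ≥ 1 - ε`. -/
def fidelityBall (ε : ℝ) (ρ : Matrix ι ι ℂ) : Set (Matrix ι ι ℂ) :=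
  {ρ' | IsState ρ' ∧ 1 - ε ≤ fidelity ρ' ρ}

/-- `-log₂ x` as an extended real, equal to `+∞` at `x = 0` (and for `x < 0`). -/
def negLog (x : ℝ) : EReal :=
  if 0 < x then ((-Real.logb 2 x : ℝ) : EReal) else ⊤

/-- `2^(-x)`, with `2^(-∞) = 0`. (Only used for `x ≠ ⊥`.) -/
def twoPowNeg (x : EReal) : ℝ :=
  if x = ⊤ then 0 else (2 : ℝ) ^ (-x.toReal)

/-- Hypothesis testing relative entropy: the maximum of `-log₂ Tr(P σ)` over the operators
`0 ≤ P ≤ 1` with `Tr(P ρ) ≥ 1 - ε`. -/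
def DH (ε : ℝ) (ρ σ : Matrix ι ι ℂ) : EReal :=
  ⨆ P ∈ {P : Matrix ι ι ℂ | P.PosSemidef ∧ (1 - P).PosSemidef ∧ 1 - ε ≤ (P * ρ).trace.re},
    negLog (P * σ).trace.re

/-- The hypothesis testing relative entropy of `ρ` with respect to `Λ ρ`. -/
def DHMap (ε : ℝ) (Λ : SuperOp ι ι) (ρ : Matrix ι ι ℂ) : EReal :=
  DH ε ρ (Λ ρ)

/-- The fidelity of `ρ` and `Λ ρ`. -/
def fidelityMap (Λ : SuperOp ι ι) (ρ : Matrix ι ι ℂ) : ℝ :=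
  fidelity ρ (Λ ρ)

/-- The modification coefficient `-log₂ f(φ, Λ φ) / log₂ d` of a state `φ` of dimension `d`. -/
def modCoeff {d : ℕ} (Λ : SuperOp (Fin d) (Fin d)) (φ : Matrix (Fin d) (Fin d) ℂ) : ℝ :=
  -Real.logb 2 (fidelityMap Λ φ) / Real.logb 2 d

/-- The dimensions `d ∈ 𝔻` for which `φ d` can be obtained from `ρ`, up to error `ε` on the output,
by an operation of the class `Ops d`. -/
def distillable (𝔻 : Set ℕ) (Ops : ∀ d : ℕ, Set (SuperOp ι (Fin d))) (ε : ℝ)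
    (ρ : Matrix ι ι ℂ) (φ : ∀ d : ℕ, Matrix (Fin d) (Fin d) ℂ) : Set ℕ :=
  {d | d ∈ 𝔻 ∧ ∃ E ∈ Ops d, E ρ ∈ fidelityBall ε (φ d)}

/-- One-shot `ε`-distillation yield: `log₂` of the largest distillable dimension. As a supremum in
the extended reals it is `+∞` if there are arbitrarily large distillable dimensions and `-∞` if
there is none. -/
def distillationYield (𝔻 : Set ℕ) (Ops : ∀ d : ℕ, Set (SuperOp ι (Fin d))) (ε : ℝ)
    (ρ : Matrix ι ι ℂ) (φ : ∀ d : ℕ, Matrix (Fin d) (Fin d) ℂ) : EReal :=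
  ⨆ d ∈ distillable 𝔻 Ops ε ρ φ, ((Real.logb 2 d : ℝ) : EReal)

end

end OneShot

namespace OneShot

open scoped ComplexOrder MatrixOrder
open Matrix

/-! ### Trace pairing and positivity -/

section Trace

variable {ι : Type*} [Fintype ι]

/-! Let `E` commute with the RD channels and send `ρ` near `Φ`. The pulled-back test `P = E†(Φ)` has
`Tr Pρ = Tr Φ E(ρ) ≥ 1 - ε`, so it is feasible for the hypothesis testing entropy, and `2^(-D) ≤ Tr
P Λ₀(ρ)`. By commutation this trace is `Tr Φ Λ(E ρ) = Tr Q E(ρ)` with `Q = Λ†(Φ)`. Replacing `E ρ`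
by `Φ` costs at most `2√ε` (`IsPureState.trace_effect_sub_le`) and leaves `Tr Φ Λ(Φ)`, the fidelity
of `Φ` with `Λ Φ`. Hence every distillable `d` competes in the maximum defining `d₀`. The second
bound follows from `m · log d₀ = -log f(Φ_{d₀}, Λ Φ_{d₀})`. -/

theorem trace_mul_vecMulVec_star (P : Matrix ι ι ℂ) (x : ι → ℂ) :
    (P * vecMulVec x (star x)).trace = star x ⬝ᵥ (P *ᵥ x) := by
  rw [mul_vecMulVec, trace_vecMulVec, dotProduct_comm]

variable [DecidableEq ι]

/-- Over `ℂ` a real-valued quadratic form already forces `P` to be Hermitian. -/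
theorem posSemidef_of_forall_dotProduct {P : Matrix ι ι ℂ}
    (h : ∀ x : ι → ℂ, 0 ≤ star x ⬝ᵥ (P *ᵥ x)) : P.PosSemidef := by
  rw [← Matrix.isPositive_toEuclideanLin_iff, LinearMap.isPositive_iff_complex]
  intro x
  have hx := h (WithLp.ofLp x)
  have e : inner ℂ (Matrix.toEuclideanLin P x) x = star (star x.ofLp ⬝ᵥ (P *ᵥ x.ofLp)) := by
    rw [EuclideanSpace.inner_eq_star_dotProduct, Matrix.ofLp_toLpLin, Matrix.toLin'_apply]
    rw [star_dotProduct, star_star, dotProduct_comm]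
  rw [e]
  obtain ⟨h1, h2⟩ := Complex.nonneg_iff.1 hx
  refine ⟨?_, by simpa using h1⟩
  apply Complex.ext <;> simp [← h2]

theorem posSemidef_of_forall_trace {P : Matrix ι ι ℂ}
    (h : ∀ X : Matrix ι ι ℂ, X.PosSemidef → 0 ≤ (P * X).trace) : P.PosSemidef :=
  posSemidef_of_forall_dotProduct fun x => by
    rw [← trace_mul_vecMulVec_star]
    exact h _ (posSemidef_vecMulVec_self_star x)

theorem trace_mul_nonneg {A B : Matrix ι ι ℂ} (hA : A.PosSemidef) (hB : B.PosSemidef) :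
    0 ≤ (A * B).trace := by
  obtain ⟨C, rfl⟩ := CStarAlgebra.nonneg_iff_eq_star_mul_self.mp hB.nonneg
  rw [← mul_assoc, trace_mul_comm, ← mul_assoc, star_eq_conjTranspose]
  exact (hA.mul_mul_conjTranspose_same C).trace_nonneg

theorem exists_eq_trace_mul (f : Matrix ι ι ℂ →ₗ[ℂ] ℂ) :
    ∃ P : Matrix ι ι ℂ, ∀ X, f X = (P * X).trace := by
  -- The indices are swapped because `Tr(PX)` pairs `P i j` with `X j i`.
  refine ⟨Matrix.of fun i j => f (single j i 1), fun X => ?_⟩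
  conv_lhs => rw [matrix_eq_sum_single X]
  simp only [map_sum, trace, diag, mul_apply, of_apply]
  rw [Finset.sum_comm]
  refine Finset.sum_congr rfl fun i _ => Finset.sum_congr rfl fun j _ => ?_
  rw [show single j i (X j i) = X j i • single j i (1 : ℂ) by simp [smul_single], map_smul,
    smul_eq_mul, mul_comm]

end Trace

/-! ### Channels and their adjoints on effects -/

section Channel

theorem IsCompletelyPositive.posSemidef_apply {ι κ : Type*} {E : SuperOp ι κ} (hE : IsCompletelyPositive E)
    {X : Matrix ι ι ℂ} (hX : X.PosSemidef) : (E X).PosSemidef :=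
  (hE 1 (Matrix.of fun _ _ => X) (hX.submatrix Prod.snd)).submatrix fun i => ((0 : Fin 1), i)

variable {ι κ : Type*} [Fintype ι] [Fintype κ]

theorem IsChannel.isState_apply {E : SuperOp ι κ} (hE : IsChannel E)
    {ρ : Matrix ι ι ℂ} (hρ : IsState ρ) : IsState (E ρ) :=
  ⟨hE.1.posSemidef_apply hρ.1, (hE.2 ρ).trans hρ.2⟩

variable [DecidableEq ι] [DecidableEq κ]

/-- The adjoint of a channel maps effects to effects. -/
theorem IsChannel.exists_dual_effect {E : SuperOp ι κ} (hE : IsChannel E) {Q : Matrix κ κ ℂ}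
    (hQ : Q.PosSemidef) (hQ' : (1 - Q).PosSemidef) :
    ∃ P : Matrix ι ι ℂ, P.PosSemidef ∧ (1 - P).PosSemidef ∧
      ∀ X, (P * X).trace = (Q * E X).trace := by
  obtain ⟨P, hP⟩ := exists_eq_trace_mul (traceLinearMap κ ℂ ℂ ∘ₗ LinearMap.mulLeft ℂ Q ∘ₗ E)
  replace hP : ∀ X, (P * X).trace = (Q * E X).trace := fun X => (hP X).symm
  refine ⟨P, posSemidef_of_forall_trace fun X hX => ?_,
    posSemidef_of_forall_trace fun X hX => ?_, hP⟩
  · rw [hP]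
    exact trace_mul_nonneg hQ (hE.1.posSemidef_apply hX)
  · have := trace_mul_nonneg hQ' (hE.1.posSemidef_apply hX)
    rwa [sub_mul, one_mul, trace_sub, hE.2, ← hP, ← trace_sub, ← one_mul X, ← mul_assoc, mul_one,
      ← sub_mul] at this

end Channel

/-! ### Fidelity with pure states and perturbation of effects -/

section Pure

variable {ι : Type*} [Fintype ι]

theorem IsPureState.isState {Φ : Matrix ι ι ℂ} (hΦ : IsPureState Φ) : IsState Φ := by
  obtain ⟨ψ, hψ, rfl⟩ := hΦ
  exact ⟨posSemidef_vecMulVec_self_star ψ, by rw [trace_vecMulVec, dotProduct_comm, hψ]⟩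

theorem IsPureState.mul_mul_self {Φ : Matrix ι ι ℂ} (hΦ : IsPureState Φ) (Q : Matrix ι ι ℂ) :
    Φ * Q * Φ = (Q * Φ).trace • Φ := by
  obtain ⟨ψ, hψ, rfl⟩ := hΦ
  rw [trace_mul_vecMulVec_star, mul_assoc, mul_vecMulVec, vecMulVec_mul_vecMulVec, vecMulVec_smul]

variable [DecidableEq ι]

theorem IsPureState.mul_self {Φ : Matrix ι ι ℂ} (hΦ : IsPureState Φ) : Φ * Φ = Φ := by
  simpa [hΦ.isState.2] using hΦ.mul_mul_self 1

theorem IsPureState.posSemidef_one_sub {Φ : Matrix ι ι ℂ} (hΦ : IsPureState Φ) :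
    (1 - Φ).PosSemidef := by
  have h : (1 - Φ)ᴴ = 1 - Φ := by simp [hΦ.isState.1.isHermitian.eq]
  have := posSemidef_conjTranspose_mul_self (1 - Φ)
  rwa [h, mul_sub, mul_one, sub_mul, one_mul, hΦ.mul_self, sub_self, sub_zero] at this

/-- For `v ≠ 0` the root of `vv*` is `vv*/‖v‖`, of trace `‖v‖`. -/
theorem trace_sqrt_vecMulVec_star (v : ι → ℂ) :
    (CFC.sqrt (vecMulVec v (star v))).trace.re ^ 2 = (star v ⬝ᵥ v).re := by
  have hn : 0 ≤ star v ⬝ᵥ v := dotProduct_star_self_nonneg v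
  obtain ⟨h1, h2⟩ := Complex.nonneg_iff.1 hn
  set n := (star v ⬝ᵥ v).re with hdef
  have hc : star v ⬝ᵥ v = (n : ℂ) := Complex.ext rfl (by simp [← h2])
  by_cases h0 : n = 0
  · have : v = 0 := by
      rw [h0, Complex.ofReal_zero] at hc
      exact dotProduct_star_self_eq_zero.1 hc
    simp [h0, this]
  have hs : CFC.sqrt (vecMulVec v (star v)) = (((√n)⁻¹ : ℝ) : ℂ) • vecMulVec v (star v) := by
    apply CFC.sqrt_unique
    · rw [smul_mul_smul_comm, vecMulVec_mul_vecMulVec, hc, vecMulVec_smul, smul_smul,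
        ← Complex.ofReal_mul, ← Complex.ofReal_mul, ← mul_inv, Real.mul_self_sqrt h1,
        inv_mul_cancel₀ h0, Complex.ofReal_one, one_smul]
    · exact ((posSemidef_vecMulVec_self_star v).smul
        (Complex.zero_le_real.2 (inv_nonneg.2 (Real.sqrt_nonneg n)))).nonneg
  rw [hs, trace_smul, trace_vecMulVec, dotProduct_comm, hc, smul_eq_mul, ← Complex.ofReal_mul,
    Complex.ofReal_re, mul_pow, inv_pow, Real.sq_sqrt h1]
  field_simp

theorem IsPureState.fidelity_right {Φ ω : Matrix ι ι ℂ} (hΦ : IsPureState Φ)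
    (hω : ω.PosSemidef) : fidelity ω Φ = (Φ * ω).trace.re := by
  have hs : CFC.sqrt Φ = Φ := CFC.sqrt_unique hΦ.mul_self hΦ.isState.1.nonneg
  obtain ⟨h1, h2⟩ := Complex.nonneg_iff.1 (trace_mul_nonneg hω hΦ.isState.1)
  have hc : (ω * Φ).trace = ((ω * Φ).trace.re : ℂ) := Complex.ext rfl (by simp [← h2])
  rw [fidelity, hs, hΦ.mul_mul_self, trace_mul_comm Φ ω]
  obtain ⟨ψ, hψ, rfl⟩ := hΦ
  set w := (ω * vecMulVec ψ (star ψ)).trace.re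
  have : (ω * vecMulVec ψ (star ψ)).trace • vecMulVec ψ (star ψ)
      = vecMulVec ((√w : ℂ) • ψ) (star ((√w : ℂ) • ψ)) := by
    rw [hc, star_smul, vecMulVec_smul, smul_vecMulVec, smul_smul]
    congr 1
    simp [← Complex.ofReal_mul, Real.mul_self_sqrt h1]
  rw [this, trace_sqrt_vecMulVec_star, star_smul, smul_dotProduct, dotProduct_smul, hψ]
  simp [← Complex.ofReal_mul, Real.mul_self_sqrt h1]

theorem IsPureState.fidelity_left {Φ σ : Matrix ι ι ℂ} (hΦ : IsPureState Φ)
    (hσ : σ.PosSemidef) : fidelity Φ σ = (Φ * σ).trace.re := by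
  obtain ⟨ψ, hψ, rfl⟩ := hΦ
  have hh : (CFC.sqrt σ)ᴴ = CFC.sqrt σ := (CFC.sqrt_nonneg σ).posSemidef.isHermitian.eq
  have hv : CFC.sqrt σ * vecMulVec ψ (star ψ) * CFC.sqrt σ
      = vecMulVec (CFC.sqrt σ *ᵥ ψ) (star (CFC.sqrt σ *ᵥ ψ)) := by
    rw [mul_vecMulVec, vecMulVec_mul, star_mulVec, hh]
  rw [fidelity, hv, trace_sqrt_vecMulVec_star, trace_mul_comm, trace_mul_vecMulVec_star, star_mulVec,
    hh, ← dotProduct_mulVec, mulVec_mulVec, CFC.sqrt_mul_sqrt_self σ hσ.nonneg]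

/-- Optimisation over the free parameter of `IsPureState.trace_effect_sub_le`: `t = √s` balances the
two error terms; for `s = 0`, let `t → 0`. -/
theorem sub_le_two_mul_sqrt_of_forall_pos {x q s : ℝ} (hq : 0 ≤ q) (hq' : q ≤ 1)
    (hs : 0 ≤ s) (hs' : s ≤ 1)
    (h : ∀ t : ℝ, 0 < t → t * x ≤ t * (1 + t) * (q * (1 - s)) + (1 + t) * s) :
    x - q ≤ 2 * √s := by
  rcases hs.eq_or_lt with rfl | hs0
  · rw [Real.sqrt_zero, mul_zero, sub_nonpos]
    refine le_of_forall_pos_le_add fun t ht => ?_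
    have := h t ht
    have h1 : t * x ≤ t * ((1 + t) * q) := by linarith
    have h2 := le_of_mul_le_mul_left h1 ht
    nlinarith
  · have hr : 0 < √s := Real.sqrt_pos.2 hs0
    have hr1 : √s ≤ 1 := Real.sqrt_le_one.2 hs'
    have hsq : s = √s ^ 2 := (Real.sq_sqrt hs).symm
    set r := √s
    have := h r hr
    rw [hsq] at this
    have h1 : r * x ≤ r * ((1 + r) * (q * (1 - r ^ 2)) + (1 + r) * r) := by linarith
    have h2 := le_of_mul_le_mul_left h1 hr
    have h3 : 0 ≤ (1 - q) * (r * (1 - r)) :=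
      mul_nonneg (by linarith) (mul_nonneg hr.le (by linarith))
    have h4 : 0 ≤ q * r ^ 3 := by positivity
    nlinarith

theorem trace_re_le_one {Q ω : Matrix ι ι ℂ} (hQ : (1 - Q).PosSemidef) (hω : IsState ω) :
    (Q * ω).trace.re ≤ 1 := by
  have := (Complex.nonneg_iff.1 (trace_mul_nonneg hQ hω.1)).1
  rw [sub_mul, one_mul, trace_sub, hω.2, Complex.sub_re, Complex.one_re] at this
  linarith

/-- Effects have similar expectations in a pure state and in a state of high fidelity with it. -/
theorem IsPureState.trace_effect_sub_le {Φ ω Q : Matrix ι ι ℂ} (hΦ : IsPureState Φ)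
    (hω : IsState ω) (hQ : Q.PosSemidef) (hQ' : (1 - Q).PosSemidef) :
    (Q * ω).trace.re - (Q * Φ).trace.re ≤ 2 * √(1 - (Φ * ω).trace.re) := by
  have hΦs := hΦ.isState
  obtain ⟨hq, hqi⟩ := Complex.nonneg_iff.1 (trace_mul_nonneg hQ hΦs.1)
  have hw := (Complex.nonneg_iff.1 (trace_mul_nonneg hΦs.1 hω.1)).1
  refine sub_le_two_mul_sqrt_of_forall_pos hq (trace_re_le_one hQ' hΦs)
    (sub_nonneg.2 (trace_re_le_one hΦ.posSemidef_one_sub hω)) (by linarith) fun t ht => ?_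
  have hΦh : Φᴴ = Φ := hΦs.1.isHermitian.eq
  have hA : (((1 + t : ℝ) : ℂ) • Φ - 1)ᴴ = ((1 + t : ℝ) : ℂ) • Φ - 1 := by
    rw [conjTranspose_sub, conjTranspose_smul, conjTranspose_one, hΦh, Complex.star_def,
      Complex.conj_ofReal]
  have h1 := hQ.conjTranspose_mul_mul_same (((1 + t : ℝ) : ℂ) • Φ - 1)
  have hB : (1 - Φ)ᴴ = 1 - Φ := by rw [conjTranspose_sub, conjTranspose_one, hΦh]
  have h2 := hQ'.conjTranspose_mul_mul_same (1 - Φ)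
  rw [hA] at h1
  rw [hB] at h2
  have k1 := (Complex.nonneg_iff.1 (trace_mul_nonneg h1 hω.1)).1
  have k2 := (Complex.nonneg_iff.1 (trace_mul_nonneg h2 hω.1)).1
  have e1 : (((1 + t : ℝ) : ℂ) • Φ - 1) * Q * (((1 + t : ℝ) : ℂ) • Φ - 1)
      = ((1 + t : ℝ) : ℂ) • ((1 + t : ℝ) : ℂ) • (Φ * Q * Φ) - ((1 + t : ℝ) : ℂ) • (Φ * Q)
        - ((1 + t : ℝ) : ℂ) • (Q * Φ) + Q := by
    simp only [sub_mul, mul_sub, smul_sub, smul_mul_assoc, mul_smul_comm, one_mul, mul_one]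
    abel
  have e2 : (1 - Φ) * (1 - Q) * (1 - Φ) = 1 - Φ - Q + Φ * Q + Q * Φ - Φ * Q * Φ := by
    have : (1 - Φ) * (1 - Q) * (1 - Φ)
        = 1 - Φ - Φ + Φ * Φ - Q + Φ * Q + Q * Φ - Φ * Q * Φ := by noncomm_ring
    rw [this, hΦ.mul_self]
    abel
  have k0 : (Φ * Q * Φ * ω).trace.re = (Q * Φ).trace.re * (Φ * ω).trace.re := by
    rw [hΦ.mul_mul_self, smul_mul_assoc, trace_smul, smul_eq_mul, Complex.mul_re, ← hqi]
    simp
  rw [e1] at k1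
  rw [e2] at k2
  simp only [sub_mul, add_mul, smul_mul_assoc, trace_sub, trace_add, trace_smul, Complex.sub_re,
    Complex.add_re, smul_eq_mul, Complex.re_ofReal_mul, one_mul, hω.2, Complex.one_re, k0] at k1 k2
  -- In `k1 + (1 + t) * k2` the cross terms `Tr ΦQω` and `Tr QΦω` cancel; this is why the factor `(1
  -- + t)Φ - 1` was chosen.
  nlinarith

end Pure

/-! ### From a commuting operation to the fidelity bound -/

section Yield

theorem twoPowNeg_le_of_negLog_le {x : ℝ} (hx : 0 ≤ x) {D : EReal} (h : negLog x ≤ D) :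
    twoPowNeg D ≤ x := by
  unfold twoPowNeg
  split_ifs with hD
  · exact hx
  unfold negLog at h
  split_ifs at h with h0
  · have hb : D ≠ ⊥ := fun hb => by simp [hb] at h
    rw [← EReal.coe_toReal hD hb, EReal.coe_le_coe_iff] at h
    calc (2 : ℝ) ^ (-D.toReal) ≤ 2 ^ Real.logb 2 x :=
          Real.rpow_le_rpow_of_exponent_le one_le_two (by linarith)
      _ = x := Real.rpow_logb two_pos (by norm_num) h0
  · exact absurd (top_le_iff.1 h) hD

variable {ι κ : Type*} [Fintype ι] [DecidableEq ι] [Fintype κ] [DecidableEq κ]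

theorem twoPowNeg_DH_le {ε : ℝ} {ρ σ P : Matrix ι ι ℂ} (hσ : σ.PosSemidef) (hP : P.PosSemidef)
    (hP' : (1 - P).PosSemidef) (h : 1 - ε ≤ (P * ρ).trace.re) :
    twoPowNeg (DH ε ρ σ) ≤ (P * σ).trace.re :=
  twoPowNeg_le_of_negLog_le (Complex.nonneg_iff.1 (trace_mul_nonneg hP hσ)).1
    (le_iSup₂_of_le P ⟨hP, hP', h⟩ le_rfl)

theorem le_fidelityMap_of_mem_fidelityBall {ε : ℝ} {Λ₀ : SuperOp ι ι} {Λ : SuperOp κ κ}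
    (hΛ₀ : IsChannel Λ₀) (hΛ : IsChannel Λ) {E : SuperOp ι κ} (hE : E ∈ commutingOps Λ₀ Λ)
    {ρ : Matrix ι ι ℂ} (hρ : IsState ρ) {Φ : Matrix κ κ ℂ} (hΦ : IsPureState Φ)
    (h : E ρ ∈ fidelityBall ε Φ) :
    twoPowNeg (DHMap ε Λ₀ ρ) - 2 * √ε ≤ fidelityMap Λ Φ := by
  obtain ⟨hEc, hcomm⟩ := hE
  obtain ⟨hω, hf⟩ := h
  rw [hΦ.fidelity_right hω.1] at hf
  obtain ⟨P, hP, hP', hPE⟩ := hEc.exists_dual_effect hΦ.isState.1 hΦ.posSemidef_one_sub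
  obtain ⟨Q, hQ, hQ', hQΛ⟩ := hΛ.exists_dual_effect hΦ.isState.1 hΦ.posSemidef_one_sub
  have h1 : twoPowNeg (DHMap ε Λ₀ ρ) ≤ (P * Λ₀ ρ).trace.re :=
    twoPowNeg_DH_le (hΛ₀.isState_apply hρ).1 hP hP' (by rwa [hPE])
  have h2 : (P * Λ₀ ρ).trace = (Q * E ρ).trace := by
    rw [hPE, hQΛ]
    exact congrArg (fun X => (Φ * X).trace) (LinearMap.congr_fun hcomm ρ).symm
  have h3 := hΦ.trace_effect_sub_le hω hQ hQ'
  have h4 : √(1 - (Φ * E ρ).trace.re) ≤ √ε := Real.sqrt_le_sqrt (by linarith)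
  rw [fidelityMap, hΦ.fidelity_left (hΛ.isState_apply hΦ.isState).1, ← hQΛ]
  rw [h2] at h1
  linarith

end Yield

end OneShot

theorem theorem6
    -- the system of the primitive state, with its free states and its RD channel
    {ι : Type*} [Fintype ι] [DecidableEq ι]
    (F₀ : Set (Matrix ι ι ℂ)) (hF₀ : ∀ σ ∈ F₀, OneShot.IsState σ)
    (Λ₀ : OneShot.SuperOp ι ι) (hΛ₀ : OneShot.IsRDChannel F₀ Λ₀)
    -- the systems of the reference states, with their free states and RD channels
    (𝔻 : Set ℕ) (h𝔻 : ∀ d ∈ 𝔻, 0 < d)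
    (F : ∀ d : ℕ, Set (Matrix (Fin d) (Fin d) ℂ))
    (hF : ∀ d ∈ 𝔻, ∀ σ ∈ F d, OneShot.IsState σ)
    (Λ : ∀ d : ℕ, OneShot.SuperOp (Fin d) (Fin d))
    (hΛ : ∀ d ∈ 𝔻, OneShot.IsRDChannel (F d) (Λ d))
    (Φ : ∀ d : ℕ, Matrix (Fin d) (Fin d) ℂ)
    (hΦ : ∀ d ∈ 𝔻, OneShot.IsPureState (Φ d))
    (ρ : Matrix ι ι ℂ) (hρ : OneShot.IsState ρ)
    (ε : ℝ) (hε : 0 ≤ ε)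
    (d₀ : ℕ)
    (hd₀ : IsGreatest {d | d ∈ 𝔻 ∧
      OneShot.fidelityMap (Λ d) (Φ d) ≥
        OneShot.twoPowNeg (OneShot.DHMap ε Λ₀ ρ) - 2 * √ε} d₀) :
    OneShot.distillationYield 𝔻 (fun d => OneShot.commutingOps Λ₀ (Λ d)) ε ρ Φ
        ≤ ((Real.logb 2 d₀ : ℝ) : EReal) ∧
      (0 < OneShot.twoPowNeg (OneShot.DHMap ε Λ₀ ρ) - 2 * √ε →
        0 < OneShot.modCoeff (Λ d₀) (Φ d₀) →
        OneShot.distillationYield 𝔻 (fun d => OneShot.commutingOps Λ₀ (Λ d)) ε ρ Φ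
          ≤ ((-Real.logb 2 (OneShot.twoPowNeg (OneShot.DHMap ε Λ₀ ρ) - 2 * √ε) /
              OneShot.modCoeff (Λ d₀) (Φ d₀) : ℝ) : EReal)) := by
  have hle : OneShot.distillationYield 𝔻 (fun d => OneShot.commutingOps Λ₀ (Λ d)) ε ρ Φ
      ≤ ((Real.logb 2 d₀ : ℝ) : EReal) := by
    refine iSup₂_le fun d hd => EReal.coe_le_coe_iff.2 ?_
    obtain ⟨hd𝔻, E, hE, hball⟩ := hd
    have hdd₀ : d ≤ d₀ := hd₀.2 ⟨hd𝔻, OneShot.le_fidelityMap_of_mem_fidelityBall hΛ₀.1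
      (hΛ d hd𝔻).1 hE hρ (hΦ d hd𝔻) hball⟩
    exact Real.logb_le_logb_of_le one_lt_two (Nat.cast_pos.2 (h𝔻 d hd𝔻)) (Nat.cast_le.2 hdd₀)
  refine ⟨hle, fun hpos hm => hle.trans (EReal.coe_le_coe_iff.2 ?_)⟩
  rw [le_div_iff₀ hm]
  -- Division by zero gives `0`, so a positive coefficient excludes `log d₀ = 0`.
  have hlog : Real.logb 2 d₀ ≠ 0 := fun h0 => by simp [OneShot.modCoeff, h0] at hm
  rw [OneShot.modCoeff, mul_div_cancel₀ _ hlog, neg_le_neg_iff]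
  exact Real.logb_le_logb_of_le one_lt_two hpos hd₀.1.2
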